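/- Let $A$ be a (nonzero, complex) C*-algebra with unit $1$. For $x,y\in A$ let $C_{x,y}:A\to A$ be the bounded linear operator $C_{x,y}z=xz-zy$, put $$\rho(x,y)=\limsup_{n\to\infty}\|C_{x,y}^n1\|^{1/n},$$ and let $d(x,y)=\max\{\rho(x,y),\rho(y,x)\}$ be the spectral semidistance. An element of $A$ is called quasinilpotent if its spectrum is $\{0\}$. Let $a\in A$ be a normal element with finite spectrum, and let $b\in A$. Then $d(a,b)=0$ if and only if $a-b$ is quasinilpotent and $ab=ba$. -/

import Mathlib

namespace QNEquiv

open Filter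

noncomputable section

variable {A : Type*} [NormedRing A] [NormedAlgebra ℂ A]

/-- The bounded operator `C_{a,b} = L_a - R_b` on `A`, that is `x ↦ a * x - x * b`. -/
def commutatorOp (a b : A) : A →L[ℂ] A :=
  ContinuousLinearMap.mul ℂ A a - (ContinuousLinearMap.mul ℂ A).flip b

@[simp]
theorem commutatorOp_apply (a b x : A) : commutatorOp a b x = a * x - x * b := by
  simp [commutatorOp]

/-- `ρ(a,b) = limsup_n ‖C_{a,b}^n 1‖^{1/n}`. -/
def rho (a b : A) : ℝ :=
  limsup (fun n : ℕ => ‖(commutatorOp a b ^ n) 1‖ ^ (1 / (n : ℝ))) atTop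

/-- The sequence in the definition of `rho` is bounded above, so its `limsup` in `ℝ` is the
usual upper limit (it is bounded below by `0`). -/
theorem rho_isBoundedUnder (a b : A) :
    IsBoundedUnder (· ≤ ·) atTop
      (fun n : ℕ => ‖(commutatorOp a b ^ n) 1‖ ^ (1 / (n : ℝ))) := by
  set M : ℝ := max 1 ‖(1 : A)‖ * max 1 (‖a‖ + ‖b‖) with hM
  have h1 : (1 : ℝ) ≤ max 1 ‖(1 : A)‖ := le_max_left _ _
  have h2 : (1 : ℝ) ≤ max 1 (‖a‖ + ‖b‖) := le_max_left _ _
  have key : ∀ n : ℕ, ‖(commutatorOp a b ^ n) 1‖ ≤ ‖(1 : A)‖ * (max 1 (‖a‖ + ‖b‖)) ^ n := by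
    intro n
    induction n with
    | zero => simp
    | succ k ih =>
      rw [pow_succ', mul_apply_eq_comp, commutatorOp_apply]
      set x := (commutatorOp a b ^ k) 1
      calc ‖a * x - x * b‖ ≤ ‖a * x‖ + ‖x * b‖ := norm_sub_le _ _
        _ ≤ ‖a‖ * ‖x‖ + ‖x‖ * ‖b‖ := add_le_add (norm_mul_le _ _) (norm_mul_le _ _)
        _ = ‖x‖ * (‖a‖ + ‖b‖) := by ring
        _ ≤ (‖(1 : A)‖ * (max 1 (‖a‖ + ‖b‖)) ^ k) * max 1 (‖a‖ + ‖b‖) :=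
          mul_le_mul ih (le_max_right _ _) (by positivity) (by positivity)
        _ = _ := by ring
  refine isBoundedUnder_of_eventually_le (a := M) ?_
  filter_upwards [eventually_ge_atTop 1] with n hn
  have hn0 : n ≠ 0 := by omega
  have hle : ‖(commutatorOp a b ^ n) 1‖ ≤ M ^ n := by
    refine (key n).trans ?_
    rw [hM, mul_pow]
    refine mul_le_mul_of_nonneg_right ?_ (by positivity)
    exact (le_max_right _ _).trans (le_self_pow₀ h1 hn0)
  calc ‖(commutatorOp a b ^ n) 1‖ ^ (1 / (n : ℝ)) ≤ (M ^ n) ^ (1 / (n : ℝ)) :=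
        Real.rpow_le_rpow (norm_nonneg _) hle (by positivity)
    _ = M := by
        rw [one_div]
        exact Real.pow_rpow_inv_natCast (by positivity) hn0

/-- The spectral semidistance `d(a,b) = max {ρ(a,b), ρ(b,a)}`. -/
def spectralSemidistance (a b : A) : ℝ := max (rho a b) (rho b a)

/-- An element is quasinilpotent if its spectrum is `{0}`. -/
def IsQuasinilpotent (a : A) : Prop := spectrum ℂ a = {0}

end

end QNEquiv

namespace QNEquiv

open Filter Topology

section NormedAlgebra

variable {A : Type*} [NormedRing A] [NormedAlgebra ℂ A]

/-! If `a` and `b` commute, then `C_{a,b}^n 1 = (a - b)^n`, so by Gelfand's formula `ρ` is the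
spectral radius of `a - b`; the real content is that `d(a,b) = 0` forces commutation. Write `1 = ∑
p_z` with the spectral idempotents of `a`. Compressing `C_{a,b}^m 1` by `p_z` on the left and
`C_{b,a}^n 1` by `p_{z'}` on the right shows that `p_z (b - z)^m` and `(b - z')^n p_{z'}` decay
faster than any geometric sequence. For `z ≠ z'` the products `p_z (b - z)^m (b - z')^n p_{z'}`
satisfy a recurrence incompatible with such decay unless they vanish (`eq_zero_of_sub_eq_smul`).
Hence `p_z b p_{z'} = 0`: `b` is block diagonal and commutes with `a`. -/

theorem commutatorOp_pow_one_of_commute {a b : A} (h : Commute a b) (n : ℕ) :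
    (commutatorOp a b ^ n) 1 = (a - b) ^ n := by
  induction n with
  | zero => simp
  | succ k ih =>
    rw [pow_succ', mul_apply_eq_comp, commutatorOp_apply, ih, pow_succ', sub_mul]
    congr 1
    exact (((h.symm.sub_right (Commute.refl b)).pow_right k).eq).symm

theorem mul_commutatorOp_pow_one {a p : A} {l : ℂ} (h : p * a = l • p) (b : A) (n : ℕ) :
    p * (commutatorOp a b ^ n) 1 = p * (algebraMap ℂ A l - b) ^ n := by
  induction n with
  | zero => simp
  | succ k ih =>
    rw [pow_succ', mul_apply_eq_comp, commutatorOp_apply, mul_sub, ← mul_assoc, h,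
      smul_mul_assoc, ← mul_assoc, ih, pow_succ, ← mul_assoc, mul_sub, Algebra.smul_def,
      Algebra.commutes]

theorem commutatorOp_pow_one_mul {a p : A} {l : ℂ} (h : a * p = l • p) (b : A) (n : ℕ) :
    (commutatorOp b a ^ n) 1 * p = (b - algebraMap ℂ A l) ^ n * p := by
  induction n with
  | zero => simp
  | succ k ih =>
    rw [pow_succ', mul_apply_eq_comp, commutatorOp_apply, sub_mul, mul_assoc _ a, h,
      mul_smul_comm, mul_assoc, ih, pow_succ', mul_assoc, sub_mul, Algebra.smul_def]

theorem rho_nonneg (a b : A) : 0 ≤ rho a b :=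
  le_limsup_of_frequently_le (Frequently.of_forall fun _ => by positivity)
    (rho_isBoundedUnder a b)

/-- If `ρ(a,b)` vanishes, then `‖C_{a,b}^n 1‖` decays faster than any geometric sequence. -/
theorem exists_norm_le_of_rho_eq_zero {a b : A} (h : rho a b = 0) {ε : ℝ} (hε : 0 < ε) :
    ∃ C : ℝ, 0 ≤ C ∧ ∀ n : ℕ, ‖(commutatorOp a b ^ n) 1‖ ≤ C * ε ^ n := by
  have h1 := eventually_lt_of_limsup_lt (h.trans_lt hε) (rho_isBoundedUnder a b)
  obtain ⟨N, hN⟩ := eventually_atTop.1 h1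
  set f : ℕ → ℝ := fun n => ‖(commutatorOp a b ^ n) 1‖ / ε ^ n with hf
  have hf0 : ∀ n, 0 ≤ f n := fun n => by positivity
  -- The sum absorbs the indices `n ≤ N`; beyond them `n ≥ 1`, so the `n`-th root can be undone.
  refine ⟨1 + ∑ n ∈ Finset.range (N + 1), f n,
    add_nonneg zero_le_one (Finset.sum_nonneg fun n _ => hf0 n), fun n => ?_⟩
  rw [← div_le_iff₀ (by positivity)]
  rcases lt_or_ge n (N + 1) with hn | hn
  · have := Finset.single_le_sum (fun i _ => hf0 i) (Finset.mem_range.2 hn)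
    exact this.trans (by linarith)
  · have hlt := (hN n (by omega)).le
    have hpow := pow_le_pow_left₀ (by positivity) hlt n
    rw [one_div, Real.rpow_inv_natCast_pow (norm_nonneg _) (by omega)] at hpow
    have hs : 0 ≤ ∑ n ∈ Finset.range (N + 1), f n := Finset.sum_nonneg fun n _ => hf0 n
    exact ((div_le_one (by positivity)).2 hpow).trans (by linarith)

/-- A double sequence with `w (m, n+1) - w (m+1, n) = μ w (m, n)`, `μ ≠ 0`, vanishes as soon
as it decays at a geometric rate below `|μ| / 2`. -/
theorem eq_zero_of_sub_eq_smul {w : ℕ → ℕ → A} {μ : ℂ} (hμ : μ ≠ 0)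
    (hw : ∀ m n, w m (n + 1) - w (m + 1) n = μ • w m n) {C : ℝ}
    (hC : ∀ m n, ‖w m n‖ ≤ C * (‖μ‖ / 4) ^ (m + n)) (m n : ℕ) : w m n = 0 := by
  have hμ' : 0 < ‖μ‖ := norm_pos_iff.2 hμ
  -- Each use of the recurrence gains the factor `2 * (‖μ‖ / 4) / ‖μ‖ = 1 / 2`.
  have key : ∀ k m n, ‖w m n‖ ≤ C * (‖μ‖ / 4) ^ (m + n) * (1 / 2) ^ k := by
    intro k
    induction k with
    | zero => simpa using hC
    | succ k ih =>
      intro m n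
      have h1 : ‖μ‖ * ‖w m n‖ ≤ ‖w m (n + 1)‖ + ‖w (m + 1) n‖ := by
        rw [← norm_smul, ← hw]; exact norm_sub_le _ _
      have h2 := ih m (n + 1)
      have h3 := ih (m + 1) n
      rw [show m + 1 + n = m + n + 1 by ring] at h3
      rw [← add_assoc] at h2
      refine le_of_mul_le_mul_left (h1.trans ((add_le_add h2 h3).trans_eq ?_)) hμ'
      ring
  have hlim : Tendsto (fun k : ℕ => C * (‖μ‖ / 4) ^ (m + n) * (1 / 2 : ℝ) ^ k) atTop (𝓝 0) := by
    simpa using (tendsto_pow_atTop_nhds_zero_of_lt_one (r := (1 / 2 : ℝ)) (by norm_num)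
      (by norm_num)).const_mul (C * (‖μ‖ / 4) ^ (m + n))
  exact norm_le_zero_iff.1 (ge_of_tendsto' hlim fun k => key k m n)

theorem mul_mul_eq_zero_of_rho_eq_zero {a b p q : A} (hab : rho a b = 0) (hba : rho b a = 0)
    {l l' : ℂ} (hl : l ≠ l') (hp : p * a = l • p) (hq : a * q = l' • q) : p * b * q = 0 := by
  set μ : ℂ := l - l' with hμ
  have hμ0 : μ ≠ 0 := sub_ne_zero.2 hl
  set c : A := b - algebraMap ℂ A l with hc
  set d : A := b - algebraMap ℂ A l' with hd
  have hdc : d - c = algebraMap ℂ A μ := by simp [hc, hd, hμ]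
  set K : ℝ := 1 + ‖c‖ + ‖d‖ with hK
  have hK0 : 0 < K := by positivity
  have hpowK : ∀ {x y : A}, ‖x‖ ≤ K → ∀ n, ‖x ^ n * y‖ ≤ K ^ n * ‖y‖ := by
    intro x y hx n
    induction n with
    | zero => simp
    | succ n ih =>
      rw [pow_succ', mul_assoc, pow_succ', mul_assoc]
      exact (norm_mul_le _ _).trans (mul_le_mul hx ih (norm_nonneg _) hK0.le)
  have hpowK' : ∀ {x y : A}, ‖x‖ ≤ K → ∀ n, ‖y * x ^ n‖ ≤ K ^ n * ‖y‖ := by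
    intro x y hx n
    induction n with
    | zero => simp
    | succ n ih =>
      rw [pow_succ, ← mul_assoc, pow_succ, mul_right_comm]
      exact (norm_mul_le _ _).trans (mul_le_mul ih hx (norm_nonneg _) (by positivity))
  have hcK : ‖c‖ ≤ K := by have := norm_nonneg d; linarith
  have hdK : ‖d‖ ≤ K := by have := norm_nonneg c; linarith
  set δ : ℝ := ‖μ‖ / 4 with hδ
  have hδ0 : 0 < δ := by have := norm_pos_iff.2 hμ0; positivity
  -- Each of the two decay estimates controls only one index, the other costing powers of `K`. The
  -- rate makes the geometric mean of the two bounds exactly `δ ^ (m + n)`, since `(δ ^ 2 / K) * K =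
  -- δ ^ 2`.
  have hε : 0 < δ ^ 2 / K := by positivity
  obtain ⟨C₁, hC₁, h₁⟩ := exists_norm_le_of_rho_eq_zero hab hε
  obtain ⟨C₂, hC₂, h₂⟩ := exists_norm_le_of_rho_eq_zero hba hε
  have hpc : ∀ m, ‖p * c ^ m‖ ≤ ‖p‖ * (C₁ * (δ ^ 2 / K) ^ m) := fun m => by
    have : ‖p * c ^ m‖ = ‖p * (algebraMap ℂ A l - b) ^ m‖ := by
      rw [← neg_sub b, ← hc]
      rcases neg_one_pow_eq_or A m with h | h <;> simp [neg_pow c, h]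
    rw [this, ← mul_commutatorOp_pow_one hp]
    exact (norm_mul_le _ _).trans (mul_le_mul_of_nonneg_left (h₁ m) (norm_nonneg _))
  have hdq : ∀ n, ‖d ^ n * q‖ ≤ C₂ * (δ ^ 2 / K) ^ n * ‖q‖ := fun n => by
    rw [hd, ← commutatorOp_pow_one_mul hq]
    exact (norm_mul_le _ _).trans (mul_le_mul_of_nonneg_right (h₂ n) (norm_nonneg _))
  set w : ℕ → ℕ → A := fun m n => p * c ^ m * (d ^ n * q) with hw
  have hrec : ∀ m n, w m (n + 1) - w (m + 1) n = μ • w m n := by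
    intro m n
    have : w m (n + 1) - w (m + 1) n = p * c ^ m * ((d - c) * (d ^ n * q)) := by
      simp only [hw, pow_succ' d, pow_succ c, sub_mul, mul_sub, mul_assoc]
    rw [this, hdc, ← Algebra.smul_def, mul_smul_comm]
  set D : ℝ := ‖p‖ * ‖q‖ * (C₁ + C₂) with hD
  have hD0 : 0 ≤ D := by positivity
  have hbound : ∀ m n, ‖w m n‖ ≤ D * δ ^ (m + n) := by
    intro m n
    have e1 : ‖w m n‖ ≤ D * ((δ ^ 2 / K) ^ m * K ^ n) := by
      calc ‖w m n‖ ≤ (‖p‖ * (C₁ * (δ ^ 2 / K) ^ m)) * (K ^ n * ‖q‖) :=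
            (norm_mul_le _ _).trans
              (mul_le_mul (hpc m) (hpowK hdK n) (norm_nonneg _) (by positivity))
        _ = (‖p‖ * ‖q‖ * C₁) * ((δ ^ 2 / K) ^ m * K ^ n) := by ring
        _ ≤ _ := by gcongr; rw [hD]; gcongr; linarith
    have e2 : ‖w m n‖ ≤ D * (K ^ m * (δ ^ 2 / K) ^ n) := by
      calc ‖w m n‖ ≤ (K ^ m * ‖p‖) * (C₂ * (δ ^ 2 / K) ^ n * ‖q‖) :=
            (norm_mul_le _ _).trans
              (mul_le_mul (hpowK' hcK m) (hdq n) (norm_nonneg _) (by positivity))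
        _ = (‖p‖ * ‖q‖ * C₂) * (K ^ m * (δ ^ 2 / K) ^ n) := by ring
        _ ≤ _ := by gcongr; rw [hD]; gcongr; linarith
    refine le_of_sq_le_sq ?_ (by positivity)
    calc ‖w m n‖ ^ 2 = ‖w m n‖ * ‖w m n‖ := sq _
      _ ≤ (D * ((δ ^ 2 / K) ^ m * K ^ n)) * (D * (K ^ m * (δ ^ 2 / K) ^ n)) :=
          mul_le_mul e1 e2 (norm_nonneg _) (by positivity)
      _ = D ^ 2 * (((δ ^ 2 / K) * K) ^ m * ((δ ^ 2 / K) * K) ^ n) := by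
          rw [mul_pow _ K, mul_pow _ K]; ring
      _ = (D * δ ^ (m + n)) ^ 2 := by rw [div_mul_cancel₀ _ hK0.ne', ← pow_add, mul_pow D, pow_right_comm]
  have hzero := eq_zero_of_sub_eq_smul hμ0 hrec hbound
  have h00 : p * q = 0 := by simpa [hw] using hzero 0 0
  have h10 : p * c * q = 0 := by simpa [hw] using hzero 1 0
  rw [hc, mul_sub, sub_mul, ← Algebra.commutes, ← Algebra.smul_def, smul_mul_assoc, h00,
    smul_zero, sub_zero] at h10
  exact h10

theorem IsQuasinilpotent.spectralRadius_eq_zero {x : A} (h : IsQuasinilpotent x) :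
    spectralRadius ℂ x = 0 := by
  rw [IsQuasinilpotent] at h
  simp [spectralRadius, h]

end NormedAlgebra

section BanachAlgebra

variable {A : Type*} [NormedRing A] [NormedAlgebra ℂ A] [CompleteSpace A]

/-- A spectral value `z` of `x` gives `z ^ n` in the spectrum of `x ^ n`, so `‖z‖ ^ n ≤ ‖x ^ n‖`;
the spectrum is nonempty. -/
theorem isQuasinilpotent_of_norm_pow_le [NormOneClass A] [Nontrivial A] {x : A}
    (h : ∀ ε : ℝ, 0 < ε → ∃ C : ℝ, 0 ≤ C ∧ ∀ n : ℕ, ‖x ^ n‖ ≤ C * ε ^ n) :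
    IsQuasinilpotent x := by
  refine (spectrum.nonempty x).subset_singleton_iff.1 fun z hz => ?_
  rw [Set.mem_singleton_iff]
  by_contra hz0
  have hpos : 0 < ‖z‖ := norm_pos_iff.2 hz0
  obtain ⟨C, -, hC⟩ := h (‖z‖ / 2) (by positivity)
  have key : ∀ n : ℕ, 1 ≤ C * (1 / 2 : ℝ) ^ n := fun n => by
    have h1 := spectrum.norm_le_norm_of_mem (spectrum.pow_image_subset x n ⟨z, hz, rfl⟩)
    rw [norm_pow] at h1
    have h2 := h1.trans (hC n)
    refine le_of_mul_le_mul_left ?_ (pow_pos hpos n)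
    calc ‖z‖ ^ n * 1 ≤ C * (‖z‖ / 2) ^ n := by simpa using h2
      _ = ‖z‖ ^ n * (C * (1 / 2) ^ n) := by rw [div_pow, one_div, inv_pow]; ring
  have hlim : Tendsto (fun n : ℕ => C * (1 / 2 : ℝ) ^ n) atTop (𝓝 0) := by
    simpa using (tendsto_pow_atTop_nhds_zero_of_lt_one (r := (1 / 2 : ℝ)) (by norm_num)
      (by norm_num)).const_mul C
  linarith [ge_of_tendsto' hlim key]

theorem rho_eq_zero_of_commute {a b : A} (hab : Commute a b)
    (hs : spectralRadius ℂ (a - b) = 0) : rho a b = 0 := by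
  have h := spectrum.pow_norm_pow_one_div_tendsto_nhds_spectralRadius (a - b)
  rw [hs] at h
  refine Tendsto.limsup_eq ?_
  have h' := (ENNReal.tendsto_toReal ENNReal.zero_ne_top).comp h
  refine h'.congr fun n => ?_
  simp only [Function.comp_apply, commutatorOp_pow_one_of_commute hab]
  exact ENNReal.toReal_ofReal (by positivity)

end BanachAlgebra

/-- A normal element with finite spectrum has spectral idempotents. -/
theorem exists_spectral_idempotents {A : Type*} [CStarAlgebra A] (a : A)
    (ha : IsStarNormal a) (hfin : (spectrum ℂ a).Finite) :
    ∃ p : ℂ → A, (∀ z ∈ hfin.toFinset, a * p z = z • p z ∧ p z * a = z • p z) ∧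
      ∑ z ∈ hfin.toFinset, p z = 1 := by
  -- A finite spectrum is discrete, so indicators of points are admissible in the functional
  -- calculus.
  have hcont : ∀ f : ℂ → ℂ, ContinuousOn f (spectrum ℂ a) := fun f => hfin.continuousOn f
  have hid : cfc (fun w : ℂ => w) a = a := cfc_id' ℂ a
  refine ⟨fun z => cfc (fun w => if w = z then 1 else 0) a, fun z _ => ?_, ?_⟩
  · have h1 : a * cfc (fun w => if w = z then 1 else 0) a =
        z • cfc (fun w : ℂ => if w = z then (1 : ℂ) else 0) a := by
      conv_lhs => enter [1]; rw [← hid]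
      rw [← cfc_mul _ _ a (hcont _) (hcont _), ← cfc_smul _ _ a (hcont _)]
      refine cfc_congr fun w _ => ?_
      by_cases h : w = z <;> simp [h]
    refine ⟨h1, ?_⟩
    rw [← h1]
    conv_lhs => enter [2]; rw [← hid]
    conv_rhs => enter [1]; rw [← hid]
    exact (cfc_commute_cfc _ _ a).eq
  · rw [← cfc_sum _ a _ fun z _ => hcont _, ← cfc_one ℂ a]
    refine cfc_congr fun w hw => ?_
    simp [Finset.sum_apply, hw]

theorem commute_of_rho_eq_zero {A : Type*} [CStarAlgebra A] {a b : A}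
    (ha : IsStarNormal a) (hfin : (spectrum ℂ a).Finite)
    (hab : rho a b = 0) (hba : rho b a = 0) : Commute a b := by
  obtain ⟨p, hp, hsum⟩ := exists_spectral_idempotents a ha hfin
  have expand : ∀ x : A, x = ∑ z ∈ hfin.toFinset, ∑ z' ∈ hfin.toFinset, p z * x * p z' := by
    intro x
    simp_rw [← Finset.mul_sum, hsum, mul_one, ← Finset.sum_mul, hsum, one_mul]
  change a * b = b * a
  -- The `(z, z')` blocks are `z • p z * b * p z'` and `z' • p z * b * p z'`: equal on the diagonal,
  -- zero off it.
  rw [expand (a * b), expand (b * a)]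
  refine Finset.sum_congr rfl fun z hz => Finset.sum_congr rfl fun z' hz' => ?_
  rw [← mul_assoc (p z) a, (hp z hz).2, ← mul_assoc (p z) b, mul_assoc _ a, (hp z' hz').1,
    mul_smul_comm, smul_mul_assoc, smul_mul_assoc]
  rcases eq_or_ne z z' with rfl | hne
  · rfl
  · rw [mul_mul_eq_zero_of_rho_eq_zero hab hba hne (hp z hz).2 (hp z' hz').1, smul_zero,
      smul_zero]

end QNEquiv

open QNEquiv in
theorem mainTheorem10 {A : Type*} [CStarAlgebra A] [Nontrivial A] (a b : A)
    (ha : IsStarNormal a) (hfin : (spectrum ℂ a).Finite) :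
    QNEquiv.spectralSemidistance a b = 0 ↔
      QNEquiv.IsQuasinilpotent (a - b) ∧ Commute a b := by
  constructor
  · intro h
    have hab : rho a b = 0 := le_antisymm ((le_max_left _ _).trans h.le) (rho_nonneg a b)
    have hba : rho b a = 0 := le_antisymm ((le_max_right _ _).trans h.le) (rho_nonneg b a)
    have hc := commute_of_rho_eq_zero ha hfin hab hba
    refine ⟨isQuasinilpotent_of_norm_pow_le fun ε hε => ?_, hc⟩
    obtain ⟨C, hC, hn⟩ := exists_norm_le_of_rho_eq_zero hab hε
    exact ⟨C, hC, fun n => commutatorOp_pow_one_of_commute hc n ▸ hn n⟩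
  · rintro ⟨hq, hc⟩
    have hr := hq.spectralRadius_eq_zero
    have hr' : spectralRadius ℂ (b - a) = 0 := by
      rw [← neg_sub a b]
      refine IsQuasinilpotent.spectralRadius_eq_zero ?_
      rw [IsQuasinilpotent, ← spectrum.neg_eq, hq]
      simp
    rw [spectralSemidistance, rho_eq_zero_of_commute hc hr, rho_eq_zero_of_commute hc.symm hr',
      max_self]
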